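/- Let $d\ge 1$ be an integer and let $A_1,\dots,A_{d+1}$ be independent random points, each uniformly distributed in the interior of the unit ball $B_d=\{x\in\mathbb{R}^d:\|x\|\le 1\}$ with center $O=0$. If these points are affinely independent, then they have a unique circumsphere; let $C$ be its center, $\Omega$ its radius and $\Delta=OC=\|C\|$. Then, conditionally on the event that the points are affinely independent and their circumsphere is entirely contained in $B_d$, the following hold. 1. The triple $(\Delta,\Omega,1-\Delta-\Omega)$ has the Dirichlet distribution $\mathrm{Dir}(d,d^2,1)$. 2. Equivalently, the pair $(\Delta,\Omega)$ has the joint probability density function $$p(\delta,\omega)=\frac{d(d+1)}{B(d,d^2)}\,\delta^{d-1}\omega^{d^2-1}\qquad(\delta,\,\omega,\,\delta+\omega\in(0,1)),$$ and $p(\delta,\omega)=0$ elsewhere, where $B(a,b)=\Gamma(a)\Gamma(b)/\Gamma(a+b)$. 3. Consequently $\Delta\sim\mathrm{Be}(d,d^2+1)$ and $\Omega\sim\mathrm{Be}(d^2,d+1)$. Here, for $q_1,\dots,q_k>0$, $\mathrm{Dir}(q_1,\dots,q_k)$ is the distribution on the unit simplex $\{l_i>0,\ \sum_i l_i=1\}$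 of a random vector $(L_1,\dots,L_k)$ with $L_k=1-\sum_{i<k}L_i$ such that $(L_1,\dots,L_{k-1})$ has Lebesgue density $\frac{\Gamma(q_1+\dots+q_k)}{\prod_{i=1}^k\Gamma(q_i)}\prod_{i=1}^k l_i^{q_i-1}$ with $l_k=1-\sum_{i<k}l_i$, and $\mathrm{Be}(a,b)$ is the beta distribution, with density $x^{a-1}(1-x)^{b-1}/B(a,b)$ on $(0,1)$. -/

import Mathlib

open MeasureTheory ProbabilityTheory

noncomputable section

/-- The density, on `ℝᵐ`, of the first `m` components of a random vector with the Dirichlet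
distribution `Dir(q₀, …, qₘ)`: on the set where all of `l₀, …, lₘ` are positive, with
`lₘ = 1 - (l₀ + ⋯ + lₘ₋₁)`, it is `Γ(q₀ + ⋯ + qₘ) / ∏ Γ(qᵢ) * ∏ lᵢ ^ (qᵢ - 1)`. -/
def dirichletPDFReal {m : ℕ} (q : Fin (m + 1) → ℝ) (l : Fin m → ℝ) : ℝ :=
  if (∀ i, 0 < l i) ∧ 0 < 1 - ∑ i, l i then
    Real.Gamma (∑ i, q i) / (∏ i, Real.Gamma (q i)) *
      ((∏ i : Fin m, l i ^ (q i.castSucc - 1)) * (1 - ∑ i, l i) ^ (q (Fin.last m) - 1))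
  else 0

/-- The Dirichlet distribution with parameters `q₀, …, qₘ > 0`, a measure on `ℝᵐ⁺¹` carried by the
unit simplex: the first `m` components have the density `dirichletPDFReal q` with respect to the
Lebesgue measure of `ℝᵐ`, and the last component is one minus their sum. -/
def dirichletMeasure {m : ℕ} (q : Fin (m + 1) → ℝ) : Measure (Fin (m + 1) → ℝ) :=
  Measure.map (fun l : Fin m → ℝ => (Fin.snoc l (1 - ∑ i, l i) : Fin (m + 1) → ℝ))
    (volume.withDensity fun l => ENNReal.ofReal (dirichletPDFReal q l))

open scoped Classical in
/-- The circumsphere of `d + 1` points of `ℝᵈ`: the sphere through all of them. It is the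
circumsphere of the simplex that they span if they are affinely independent; the value for
affinely dependent points is a dummy. -/
def pointsCircumsphere {d : ℕ} (p : Fin (d + 1) → EuclideanSpace ℝ (Fin d)) :
    EuclideanGeometry.Sphere (EuclideanSpace ℝ (Fin d)) :=
  if h : AffineIndependent ℝ p then (Affine.Simplex.mk p h).circumsphere else ⟨0, 0⟩

/-- The length `Δ = OC`, where `O` is the origin and `C` the circumcenter of the points. (As the
points span the whole space, the orthogonal projection of `O` onto their flat is `O` itself.) -/
def centerDist {d : ℕ} (p : Fin (d + 1) → EuclideanSpace ℝ (Fin d)) : ℝ :=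
  dist 0 (pointsCircumsphere p).center

/-- The circumradius of the points. -/
def circumRad {d : ℕ} (p : Fin (d + 1) → EuclideanSpace ℝ (Fin d)) : ℝ :=
  (pointsCircumsphere p).radius

/-- The `(d + 1)`-tuples of points that have a circumsphere and whose circumsphere is contained in
the closed unit ball centered at the origin. -/
def circumsphereInBall (d : ℕ) : Set (Fin (d + 1) → EuclideanSpace ℝ (Fin d)) :=
  {p | AffineIndependent ℝ p ∧
    (pointsCircumsphere p : Set (EuclideanSpace ℝ (Fin d))) ⊆ Metric.closedBall 0 1}

end

/-! Under Lebesgue measure on affinely independent tuples, Δ and Ω behave as independent variables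
with power densities, and symmetry alone shows this. Translating all points by t moves the
circumcenter by t and keeps the radius. So the distribution of the center over tuples of radius at
most 1 is translation invariant, hence a multiple of Lebesgue measure (`volume_boundedTuples_one`),
and the tuples with Δ ≤ a, Ω ≤ 1 have volume proportional to a^d. Homotheties scale volume on tuples
with exponent d(d+1), which leaves b^(d²) for the radius: the volume of {Δ ≤ a, Ω ≤ b} is V a^d
b^(d²) (`volume_boundedTuples`). No Jacobian is needed.

The circumsphere lies in the unit ball iff Δ + Ω ≤ 1 (`circumsphereInBall_eq`), and then so do the
points. On this event the law of the uniform sample is thus a multiple of Lebesgue measure, and the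
conditional law of (Δ, Ω) is the product law cut off at δ + ω ≤ 1, which is Dir(d, d², 1). Constants
are carried as unknown K and fixed at the end by total mass. -/

/-- The tuples of `d + 1` affinely independent points of `ℝᵈ`. -/
def independentTuples (d : ℕ) : Set (Fin (d + 1) → EuclideanSpace ℝ (Fin d)) :=
  {p | AffineIndependent ℝ p}

/-! ### Circumspheres: uniqueness, equivariance, containment in the ball -/

section Circumsphere

open scoped Matrix

variable {d : ℕ} {p : Fin (d + 1) → EuclideanSpace ℝ (Fin d)}

theorem pointsCircumsphere_of_independent (hp : AffineIndependent ℝ p) :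
    pointsCircumsphere p = (Affine.Simplex.mk p hp).circumsphere := dif_pos hp

theorem dist_center_pointsCircumsphere (hp : AffineIndependent ℝ p) (i : Fin (d + 1)) :
    dist (p i) (pointsCircumsphere p).center = circumRad p := by
  rw [circumRad, pointsCircumsphere_of_independent hp]
  exact (Affine.Simplex.mk p hp).dist_circumcenter_eq_circumradius i

/-- The points span the whole space, so an equidistant point needs no separate check of membership
in their affine span. This gives equivariance under translations and homotheties. -/
theorem eq_center_and_circumRad_of_dist_eq (hp : AffineIndependent ℝ p)
    {c : EuclideanSpace ℝ (Fin d)} {r : ℝ} (h : ∀ i, dist (p i) c = r) :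
    c = (pointsCircumsphere p).center ∧ r = circumRad p := by
  have htop : affineSpan ℝ (Set.range p) = ⊤ := by
    rw [hp.affineSpan_eq_top_iff_card_eq_finrank_add_one]
    simp
  have hc : c ∈ affineSpan ℝ (Set.range (Affine.Simplex.mk p hp).points) := by
    change c ∈ affineSpan ℝ (Set.range p)
    rw [htop]; trivial
  rw [circumRad, pointsCircumsphere_of_independent hp]
  exact ⟨(Affine.Simplex.mk p hp).eq_circumcenter_of_dist_eq hc h,
    (Affine.Simplex.mk p hp).eq_circumradius_of_dist_eq hc h⟩

theorem circumRad_nonneg (hp : AffineIndependent ℝ p) : 0 ≤ circumRad p := by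
  rw [← dist_center_pointsCircumsphere hp 0]; exact dist_nonneg

theorem circumRad_pos (hd : 1 ≤ d) (hp : AffineIndependent ℝ p) : 0 < circumRad p := by
  refine (circumRad_nonneg hp).lt_of_ne fun h => ?_
  obtain ⟨n, rfl⟩ := Nat.exists_eq_add_of_le' hd
  have h0 := dist_center_pointsCircumsphere hp 0
  have h1 := dist_center_pointsCircumsphere hp 1
  rw [← h, dist_eq_zero] at h0 h1
  have := hp.injective (h0.trans h1.symm)
  simp at this

theorem affineIndependent_const_add_iff (t : EuclideanSpace ℝ (Fin d)) :
    AffineIndependent ℝ ((fun _ => t) + p) ↔ AffineIndependent ℝ p := by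
  have := AffineEquiv.affineIndependent_iff (k := ℝ) (p := p)
    (AffineEquiv.constVAdd ℝ (EuclideanSpace ℝ (Fin d)) t)
  exact this

theorem affineIndependent_const_smul_iff {s : ℝ} (hs : s ≠ 0) :
    AffineIndependent ℝ (s • p) ↔ AffineIndependent ℝ p :=
  AffineEquiv.affineIndependent_iff (k := ℝ) (p := p)
    (LinearEquiv.smulOfNeZero ℝ (EuclideanSpace ℝ (Fin d)) s hs).toAffineEquiv

theorem pointsCircumsphere_const_add (hp : AffineIndependent ℝ p)
    (t : EuclideanSpace ℝ (Fin d)) :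
    (pointsCircumsphere ((fun _ => t) + p)).center = t + (pointsCircumsphere p).center ∧
      circumRad ((fun _ => t) + p) = circumRad p := by
  obtain ⟨h1, h2⟩ := eq_center_and_circumRad_of_dist_eq
    ((affineIndependent_const_add_iff t).2 hp) (c := t + (pointsCircumsphere p).center)
    (r := circumRad p) fun i => by
      simpa using dist_center_pointsCircumsphere hp i
  exact ⟨h1.symm, h2.symm⟩

theorem pointsCircumsphere_const_smul (hp : AffineIndependent ℝ p) {s : ℝ} (hs : 0 < s) :
    centerDist (s • p) = s * centerDist p ∧ circumRad (s • p) = s * circumRad p := by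
  obtain ⟨h1, h2⟩ := eq_center_and_circumRad_of_dist_eq
    ((affineIndependent_const_smul_iff hs.ne').2 hp) (c := s • (pointsCircumsphere p).center)
    (r := s * circumRad p) fun i => by
      rw [Pi.smul_apply, dist_smul₀, Real.norm_of_nonneg hs.le,
        dist_center_pointsCircumsphere hp i]
  refine ⟨?_, h2.symm⟩
  rw [centerDist, centerDist, ← h1, dist_zero_left, dist_zero_left, norm_smul,
    Real.norm_of_nonneg hs.le]

theorem isOpen_independentTuples (d : ℕ) : IsOpen (independentTuples d) :=
  isOpen_setOfPred_affineIndependent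

theorem independentTuples_nonempty (d : ℕ) : (independentTuples d).Nonempty := by
  obtain ⟨b⟩ := AffineBasis.exists_affineBasis_of_finiteDimensional (k := ℝ)
    (ι := Fin (d + 1)) (P := EuclideanSpace ℝ (Fin d)) (by simp)
  exact ⟨b, b.ind⟩

/-- The point of the sphere farthest from the origin is at distance Δ + Ω, in the direction of the
center. -/
theorem circumsphereInBall_eq (hd : 1 ≤ d) :
    circumsphereInBall d = independentTuples d ∩ {p | centerDist p + circumRad p ≤ 1} := by
  ext p
  refine and_congr_right fun hp => ?_
  have hr := circumRad_nonneg hp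
  simp only [centerDist, dist_zero_left, Set.mem_ofPred_eq]
  set c := (pointsCircumsphere p).center
  constructor
  · intro h
    obtain ⟨u, hu, hcu⟩ : ∃ u : EuclideanSpace ℝ (Fin d), ‖u‖ = 1 ∧ c = ‖c‖ • u := by
      by_cases hc : c = 0
      -- When the center is the origin any unit vector serves; one exists because d ≥ 1.
      · have : Nonempty (Fin d) := ⟨⟨0, hd⟩⟩
        obtain ⟨u, hu⟩ := exists_norm_eq (EuclideanSpace ℝ (Fin d)) zero_le_one
        exact ⟨u, hu, by simp [hc]⟩
      · refine ⟨‖c‖⁻¹ • c, norm_smul_inv_norm hc, ?_⟩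
        rw [smul_inv_smul₀ (norm_ne_zero_iff.2 hc)]
    have hmem : c + circumRad p • u ∈ pointsCircumsphere p := by
      rw [EuclideanGeometry.mem_sphere, dist_eq_norm]
      change ‖c + circumRad p • u - c‖ = circumRad p
      rw [add_sub_cancel_left, norm_smul, hu, mul_one, Real.norm_of_nonneg hr]
    have := h hmem
    rwa [mem_closedBall_zero_iff, hcu, ← add_smul, norm_smul, hu, mul_one,
      Real.norm_of_nonneg (by positivity)] at this
  · intro h x hx
    have hx' : dist x c = circumRad p := EuclideanGeometry.mem_sphere.1 hx
    rw [mem_closedBall_zero_iff]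
    rw [dist_eq_norm] at hx'
    calc ‖x‖ = ‖(x - c) + c‖ := by rw [sub_add_cancel]
      _ ≤ ‖x - c‖ + ‖c‖ := norm_add_le _ _
      _ ≤ 1 := by linarith

theorem circumsphereInBall_subset_closedBall :
    circumsphereInBall d ⊆ Set.univ.pi fun _ => Metric.closedBall 0 1 := fun _ hp i _ =>
  hp.2 (EuclideanGeometry.mem_sphere.2 (dist_center_pointsCircumsphere hp.1 i))

/-! ### Measurability of the circumcenter and circumradius -/

/-- The matrix of the linear system satisfied by the circumcenter. -/
noncomputable def edgeMatrix (p : Fin (d + 1) → EuclideanSpace ℝ (Fin d)) :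
    Matrix (Fin d) (Fin d) ℝ :=
  Matrix.of fun i j => p i.succ j - p 0 j

/-- The right-hand side of the linear system satisfied by the circumcenter. -/
noncomputable def edgeVector (p : Fin (d + 1) → EuclideanSpace ℝ (Fin d)) : Fin d → ℝ :=
  fun i => (‖p i.succ‖ ^ 2 - ‖p 0‖ ^ 2) / 2

theorem isUnit_edgeMatrix (hp : AffineIndependent ℝ p) : IsUnit (edgeMatrix p) := by
  rw [← Matrix.linearIndependent_rows_iff_isUnit]
  have h := (affineIndependent_iff_linearIndependent_vsub ℝ p 0).1 hp
  have h' := (h.comp (fun i : Fin d => ⟨i.succ, Fin.succ_ne_zero i⟩)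
    fun i j hij => by simpa using hij).map' (EuclideanSpace.equiv (Fin d) ℝ).toLinearEquiv.toLinearMap
      (LinearEquiv.ker _)
  exact h'

theorem edgeMatrix_mulVec_center (hp : AffineIndependent ℝ p) :
    edgeMatrix p *ᵥ (pointsCircumsphere p).center.ofLp = edgeVector p := by
  funext i
  have h1 := dist_center_pointsCircumsphere hp i.succ
  have h0 := dist_center_pointsCircumsphere hp 0
  set c := (pointsCircumsphere p).center
  have h : ‖p i.succ - c‖ ^ 2 = ‖p 0 - c‖ ^ 2 := by
    rw [← dist_eq_norm, ← dist_eq_norm, h1, h0]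
  rw [norm_sub_sq_real, norm_sub_sq_real] at h
  have h2 : (edgeMatrix p *ᵥ c.ofLp) i = inner ℝ (p i.succ) c - inner ℝ (p 0) c := by
    simp only [Matrix.mulVec, dotProduct, edgeMatrix, Matrix.of_apply, PiLp.inner_apply,
      ← Finset.sum_sub_distrib]
    refine Finset.sum_congr rfl fun j _ => ?_
    simp
    ring
  rw [h2, edgeVector]
  linarith

/-- Cramer's rule: the center is a rational function of the points on an open set, whence its
measurability. -/
theorem center_eq_adjugate (hp : AffineIndependent ℝ p) :
    (pointsCircumsphere p).center =
      WithLp.toLp 2 ((edgeMatrix p).det⁻¹ • ((edgeMatrix p).adjugate *ᵥ edgeVector p)) := by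
  have hdet : (edgeMatrix p).det ≠ 0 :=
    ((Matrix.isUnit_iff_isUnit_det _).1 (isUnit_edgeMatrix hp)).ne_zero
  rw [← edgeMatrix_mulVec_center hp, Matrix.mulVec_mulVec, Matrix.adjugate_mul,
    Matrix.smul_mulVec, Matrix.one_mulVec, inv_smul_smul₀ hdet]

theorem continuous_edgeMatrix (d : ℕ) : Continuous (edgeMatrix (d := d)) := by
  refine continuous_matrix fun i j => ?_
  simp only [edgeMatrix, Matrix.of_apply]
  fun_prop

theorem measurable_center (d : ℕ) : Measurable
    fun p : Fin (d + 1) → EuclideanSpace ℝ (Fin d) => (pointsCircumsphere p).center := by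
  classical
  have hform : Measurable fun p : Fin (d + 1) → EuclideanSpace ℝ (Fin d) =>
      WithLp.toLp 2 ((edgeMatrix p).det⁻¹ • ((edgeMatrix p).adjugate *ᵥ edgeVector p)) := by
    have h1 : Measurable fun p : Fin (d + 1) → EuclideanSpace ℝ (Fin d) =>
        (edgeMatrix p).det⁻¹ := (continuous_edgeMatrix d).matrix_det.measurable.inv
    have h2 : Measurable fun p : Fin (d + 1) → EuclideanSpace ℝ (Fin d) =>
        (edgeMatrix p).adjugate *ᵥ edgeVector p := by
      refine ((continuous_edgeMatrix d).matrix_adjugate.matrix_mulVec ?_).measurable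
      unfold edgeVector
      fun_prop
    exact (by fun_prop : Measurable (WithLp.toLp 2 : (Fin d → ℝ) → _)).comp (h1.smul h2)
  have : (fun p : Fin (d + 1) → EuclideanSpace ℝ (Fin d) => (pointsCircumsphere p).center) =
      fun p => if p ∈ independentTuples d then
        WithLp.toLp 2 ((edgeMatrix p).det⁻¹ • ((edgeMatrix p).adjugate *ᵥ edgeVector p))
        else 0 := by
    funext p
    split_ifs with hp
    · exact center_eq_adjugate hp
    · rw [pointsCircumsphere, dif_neg (show ¬AffineIndependent ℝ p from hp)]
  rw [this]
  exact Measurable.ite (isOpen_independentTuples d).measurableSet hform measurable_const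

theorem measurable_centerDist (d : ℕ) : Measurable (centerDist (d := d)) :=
  measurable_const.dist (measurable_center d)

theorem measurable_circumRad (d : ℕ) : Measurable (circumRad (d := d)) := by
  classical
  have : circumRad (d := d) = fun p => if p ∈ independentTuples d then
      dist (p 0) (pointsCircumsphere p).center else 0 := by
    funext p
    split_ifs with hp
    · exact (dist_center_pointsCircumsphere hp 0).symm
    · rw [circumRad, pointsCircumsphere, dif_neg (show ¬AffineIndependent ℝ p from hp)]
  rw [this]
  exact Measurable.ite (isOpen_independentTuples d).measurableSet
    ((measurable_pi_apply 0).dist (measurable_center d)) measurable_const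

theorem measurableSet_circumsphereInBall (hd : 1 ≤ d) :
    MeasurableSet (circumsphereInBall d) := by
  rw [circumsphereInBall_eq hd]
  exact (isOpen_independentTuples d).measurableSet.inter
    (measurableSet_le ((measurable_centerDist d).add (measurable_circumRad d)) measurable_const)

end Circumsphere

/-! ### Power densities, the Dirichlet density and its beta marginals -/

/-- The measure on `ℝ` carried by `(0, ∞)` with density `n * x ^ (n - 1)`. -/
noncomputable def powMeasure (n : ℕ) : Measure ℝ :=
  volume.withDensity fun x => ENNReal.ofReal (if 0 < x then n * x ^ (n - 1) else 0)

theorem measurable_powDensity (n : ℕ) :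
    Measurable fun x : ℝ => ENNReal.ofReal (if 0 < x then n * x ^ (n - 1) else 0) :=
  ENNReal.measurable_ofReal.comp (Measurable.ite measurableSet_Ioi (by fun_prop) (by fun_prop))

theorem powMeasure_Iic {n : ℕ} (hn : 1 ≤ n) (b : ℝ) :
    powMeasure n (Set.Iic b) = ENNReal.ofReal b ^ n := by
  rw [powMeasure, withDensity_apply _ measurableSet_Iic]
  have h1 : ∀ x : ℝ, ENNReal.ofReal (if 0 < x then n * x ^ (n - 1) else 0) =
      (Set.Ioi (0 : ℝ)).indicator (fun x => ENNReal.ofReal (n * x ^ (n - 1))) x := by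
    intro x
    by_cases hx : 0 < x <;> simp [hx]
  simp_rw [h1]
  rw [setLIntegral_indicator measurableSet_Ioi, Set.Ioi_inter_Iic]
  rcases le_total b 0 with hb | hb
  · simp [Set.Ioc_eq_empty_of_le hb, ENNReal.ofReal_of_nonpos hb, (Nat.one_le_iff_ne_zero.1 hn)]
  · rw [← ofReal_integral_eq_lintegral_ofReal, ← intervalIntegral.integral_of_le hb,
      intervalIntegral.integral_const_mul, integral_pow, ← ENNReal.ofReal_pow hb]
    · congr 1
      have h2 : n - 1 + 1 = n := by omega
      have h3 : ((n - 1 : ℕ) : ℝ) + 1 = n := by exact_mod_cast h2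
      have h4 : (n : ℝ) ≠ 0 := by positivity
      rw [h2, h3, zero_pow (by omega), sub_zero, mul_div_cancel₀ _ h4]
    · exact ((continuous_const.mul (continuous_pow _)).integrableOn_Icc).mono_set
        Set.Ioc_subset_Icc_self
    · refine (ae_restrict_iff' measurableSet_Ioc).2 (ae_of_all _ fun x hx => ?_)
      have := hx.1
      positivity

instance (n : ℕ) : NullSingletonClass (powMeasure n) := by
  unfold powMeasure; infer_instance

instance (n : ℕ) : SFinite (powMeasure n) := by
  unfold powMeasure; infer_instance

/-- The density on `ℝ²` of the first two components of the Dirichlet distribution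
`Dir(a, b, 1)`, for positive integers `a` and `b`. -/
noncomputable def jointDensity (a b : ℕ) (x : ℝ × ℝ) : ℝ :=
  if 0 < x.1 ∧ 0 < x.2 ∧ x.1 + x.2 < 1 then
    Real.Gamma (a + b + 1) / (Real.Gamma a * Real.Gamma b) * x.1 ^ (a - 1) * x.2 ^ (b - 1)
  else 0

/-- The measure on `ℝ²` with density `jointDensity a b`. -/
noncomputable def jointMeasure (a b : ℕ) : Measure (ℝ × ℝ) :=
  volume.withDensity fun x => ENNReal.ofReal (jointDensity a b x)

theorem measurable_jointDensity (a b : ℕ) : Measurable (jointDensity a b) := by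
  refine Measurable.ite ?_ (by fun_prop) measurable_const
  exact (measurableSet_lt measurable_const measurable_fst).inter
    ((measurableSet_lt measurable_const measurable_snd).inter
      (measurableSet_lt (measurable_fst.add measurable_snd) measurable_const))

theorem measurable_ofReal_jointDensity (a b : ℕ) :
    Measurable fun x => ENNReal.ofReal (jointDensity a b x) :=
  ENNReal.measurable_ofReal.comp (measurable_jointDensity a b)

theorem jointConst_pos {a b : ℕ} (ha : 1 ≤ a) (hb : 1 ≤ b) :
    0 < Real.Gamma (a + b + 1) / (Real.Gamma a * Real.Gamma b) := by
  have ha' : (0 : ℝ) < a := by exact_mod_cast ha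
  have hb' : (0 : ℝ) < b := by exact_mod_cast hb
  exact div_pos (Real.Gamma_pos_of_pos (by positivity))
    (mul_pos (Real.Gamma_pos_of_pos ha') (Real.Gamma_pos_of_pos hb'))

/-- Integrating y^(b-1) over (0, 1-x) gives (1-x)^b / b, and the factor b is absorbed by Γ(b+1) = b
Γ(b). -/
theorem lintegral_jointDensity_right {a b : ℕ} (ha : 1 ≤ a) (hb : 1 ≤ b) (x : ℝ) :
    ∫⁻ y, ENNReal.ofReal (jointDensity a b (x, y)) = betaPDF a (b + 1) x := by
  by_cases hx : 0 < x ∧ x < 1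
  · have ha' : (0 : ℝ) < a := by exact_mod_cast ha
    have hb' : (0 : ℝ) < b := by exact_mod_cast hb
    have hc := jointConst_pos ha hb
    set K : ℝ := Real.Gamma (a + b + 1) / (Real.Gamma a * Real.Gamma b) * x ^ (a - 1) / b with hK
    have hK0 : 0 ≤ K := by have := hx.1; positivity
    have h1 : ∀ y, ENNReal.ofReal (jointDensity a b (x, y)) = (Set.Iio (1 - x)).indicator
        (fun y => ENNReal.ofReal K * ENNReal.ofReal (if 0 < y then b * y ^ (b - 1) else 0)) y := by
      intro y
      by_cases hy : 0 < y
      · by_cases hxy : y < 1 - x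
        · have : x + y < 1 := by linarith
          rw [Set.indicator_of_mem (show y ∈ Set.Iio (1 - x) from hxy), ← ENNReal.ofReal_mul hK0]
          simp only [jointDensity, hx.1, hy, this, and_self, if_true]
          congr 1
          rw [hK]
          field_simp
        · have : ¬ (x + y < 1) := by linarith
          rw [Set.indicator_of_notMem (by simpa using hxy)]
          simp [jointDensity, this]
      · simp [jointDensity, hy, Set.indicator]
    simp_rw [h1]
    rw [lintegral_indicator measurableSet_Iio,
      lintegral_const_mul _ (measurable_powDensity b), ← withDensity_apply _ measurableSet_Iio]
    change _ * powMeasure b _ = _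
    rw [measure_congr Iio_ae_eq_Iic, powMeasure_Iic hb, betaPDF_of_pos_lt_one hx.1 hx.2,
      ← ENNReal.ofReal_pow (by linarith), ← ENNReal.ofReal_mul hK0]
    congr 1
    have e1 : x ^ ((a : ℝ) - 1) = x ^ (a - 1) := by
      rw [← Real.rpow_natCast, Nat.cast_sub ha, Nat.cast_one]
    have e2 : (1 - x) ^ ((b : ℝ) + 1 - 1) = (1 - x) ^ b := by
      rw [add_sub_cancel_right, Real.rpow_natCast]
    rw [e1, e2, hK, beta, Real.Gamma_add_one hb'.ne', ← add_assoc]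
    have := (Real.Gamma_pos_of_pos ha').ne'
    have := (Real.Gamma_pos_of_pos hb').ne'
    have := (Real.Gamma_pos_of_pos (show (0 : ℝ) < a + b + 1 by positivity)).ne'
    field_simp
  · have h1 : ∀ y, jointDensity a b (x, y) = 0 := fun y =>
      if_neg fun h => hx ⟨h.1, by have := h.2.1; have := h.2.2; simp only at *; linarith⟩
    simp [h1, betaPDF_eq, hx]

theorem map_fst_jointMeasure {a b : ℕ} (ha : 1 ≤ a) (hb : 1 ≤ b) :
    (jointMeasure a b).map Prod.fst = betaMeasure a (b + 1) := by
  ext S hS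
  rw [Measure.map_apply measurable_fst hS, jointMeasure, betaMeasure, withDensity_apply _ hS,
    withDensity_apply _ (measurable_fst hS), ← Set.prod_univ, Measure.volume_eq_prod,
    ← Measure.prod_restrict, Measure.restrict_univ, 
    lintegral_prod _ (measurable_ofReal_jointDensity a b).aemeasurable]
  simp_rw [lintegral_jointDensity_right ha hb]

theorem map_swap_jointMeasure (a b : ℕ) :
    (jointMeasure a b).map Prod.swap = jointMeasure b a := by
  have hs : ∀ x, jointDensity a b x.swap = jointDensity b a x := by
    intro x
    unfold jointDensity
    by_cases h : 0 < x.1 ∧ 0 < x.2 ∧ x.1 + x.2 < 1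
    · rw [if_pos h, if_pos ⟨h.2.1, h.1, by simpa [add_comm] using h.2.2⟩, Prod.fst_swap,
        Prod.snd_swap, mul_comm (Real.Gamma a), add_comm (a : ℝ) b]
      ring
    · rw [if_neg h, if_neg fun h' => h ⟨h'.2.1, h'.1, by simpa [add_comm] using h'.2.2⟩]
  ext S hS
  have hmp : MeasurePreserving (Prod.swap : ℝ × ℝ → ℝ × ℝ) := Measure.measurePreserving_swap
  rw [Measure.map_apply measurable_swap hS, jointMeasure, jointMeasure,
    withDensity_apply _ (measurable_swap hS), withDensity_apply _ hS]
  rw [← hmp.setLIntegral_comp_preimage hS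
    (measurable_ofReal_jointDensity b a)]
  simp [← hs]

theorem map_snd_jointMeasure {a b : ℕ} (ha : 1 ≤ a) (hb : 1 ≤ b) :
    (jointMeasure a b).map Prod.snd = betaMeasure b (a + 1) := by
  rw [← map_fst_jointMeasure hb ha, ← map_swap_jointMeasure a b,
    Measure.map_map measurable_fst measurable_swap]
  rfl

/-- Total mass is preserved by projection, and the marginal is a beta law. -/
theorem isProbabilityMeasure_jointMeasure {a b : ℕ} (ha : 1 ≤ a) (hb : 1 ≤ b) :
    IsProbabilityMeasure (jointMeasure a b) := by
  have ha' : (0 : ℝ) < a := by exact_mod_cast ha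
  have : IsProbabilityMeasure ((jointMeasure a b).map Prod.fst) := by
    rw [map_fst_jointMeasure ha hb]
    exact isProbabilityMeasureBeta ha' (by positivity)
  exact Measure.isProbabilityMeasure_of_map Prod.fst

theorem volume_antidiagonal_line :
    volume {x : ℝ × ℝ | x.1 + x.2 = 1} = 0 := by
  have hm : MeasurableSet {x : ℝ × ℝ | x.1 + x.2 = 1} :=
    measurableSet_eq_fun (measurable_fst.add measurable_snd) measurable_const
  rw [Measure.volume_eq_prod, Measure.measure_prod_null hm]
  refine ae_of_all _ fun x => ?_
  have : Prod.mk x ⁻¹' {x : ℝ × ℝ | x.1 + x.2 = 1} = {1 - x} := by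
    ext y
    simp [eq_sub_iff_add_eq, add_comm]
  simp [this]

theorem restrict_prod_powMeasure {a b : ℕ} (ha : 1 ≤ a) (hb : 1 ≤ b) :
    ∃ K : ENNReal, K ≠ 0 ∧ K ≠ ⊤ ∧
      ((powMeasure a).prod (powMeasure b)).restrict {x | x.1 + x.2 ≤ 1} =
        K • jointMeasure a b := by
  have ha' : (0 : ℝ) < a := by exact_mod_cast ha
  have hb' : (0 : ℝ) < b := by exact_mod_cast hb
  have hc := jointConst_pos ha hb
  set c : ℝ := Real.Gamma (a + b + 1) / (Real.Gamma a * Real.Gamma b) with hc_def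
  have hK : 0 < a * b / c := by positivity
  -- The power densities contribute a * b; c is the Dirichlet constant.
  refine ⟨ENNReal.ofReal (a * b / c), by simpa using hK, ENNReal.ofReal_ne_top, ?_⟩
  have hD : MeasurableSet {x : ℝ × ℝ | x.1 + x.2 ≤ 1} :=
    measurableSet_le (measurable_fst.add measurable_snd) measurable_const
  rw [powMeasure, powMeasure, prod_withDensity (measurable_powDensity a) (measurable_powDensity b),
    ← Measure.volume_eq_prod, restrict_withDensity hD, ← withDensity_indicator hD, jointMeasure,
    ← withDensity_smul _ (measurable_ofReal_jointDensity a b)]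
  refine withDensity_congr_ae ?_
  -- The event is closed (≤ 1) but the density is supported where the sum is < 1; they differ by a
  -- null line.
  have hline : ∀ᵐ x : ℝ × ℝ, ¬ (x.1 + x.2 = 1) := by
    rw [ae_iff]; simpa using volume_antidiagonal_line
  filter_upwards [hline] with x hx
  simp only [Pi.smul_apply, smul_eq_mul]
  rw [← ENNReal.ofReal_mul hK.le]
  by_cases h : 0 < x.1 ∧ 0 < x.2 ∧ x.1 + x.2 < 1
  · rw [Set.indicator_of_mem (show x ∈ {x : ℝ × ℝ | x.1 + x.2 ≤ 1} from h.2.2.le), if_pos h.1,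
      if_pos h.2.1, ← ENNReal.ofReal_mul (by have := h.1; positivity), jointDensity, if_pos h]
    congr 1
    rw [← hc_def]
    field_simp
  · rw [jointDensity, if_neg h, mul_zero, ENNReal.ofReal_zero]
    rw [Set.indicator_apply_eq_zero]
    intro hx1
    have hlt : x.1 + x.2 < 1 := lt_of_le_of_ne hx1 hx
    by_cases h1 : 0 < x.1
    · have h2 : ¬ 0 < x.2 := fun h2 => h ⟨h1, h2, hlt⟩
      simp [h2]
    · simp [h1]

/-- Γ(d + d² + 1) = d(d + 1) Γ(d + d²). -/
theorem jointDensity_eq {d : ℕ} (hd : 1 ≤ d) (x : ℝ × ℝ) :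
    (if 0 < x.1 ∧ 0 < x.2 ∧ x.1 + x.2 < 1 then
      (d : ℝ) * (d + 1) / beta d ((d : ℝ) ^ 2) * x.1 ^ (d - 1) * x.2 ^ (d ^ 2 - 1) else 0) =
      jointDensity d (d ^ 2) x := by
  have hd' : (0 : ℝ) < d := by exact_mod_cast hd
  have h1 := (Real.Gamma_pos_of_pos hd').ne'
  have h2 := (Real.Gamma_pos_of_pos (pow_pos hd' 2)).ne'
  have h3 := (Real.Gamma_pos_of_pos (show (0 : ℝ) < d + d ^ 2 by positivity)).ne'
  unfold jointDensity
  refine if_congr Iff.rfl ?_ rfl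
  push_cast
  rw [Real.Gamma_add_one (by positivity), beta]
  field_simp
  ring

theorem dirichletPDFReal_eq_jointDensity {d : ℕ} (hd : 1 ≤ d) (l : Fin 2 → ℝ) :
    dirichletPDFReal ![(d : ℝ), (d : ℝ) ^ 2, 1] l = jointDensity d (d ^ 2) (l 0, l 1) := by
  have e : ∀ (n : ℕ) (x : ℝ), 1 ≤ n → x ^ ((n : ℝ) - 1) = x ^ (n - 1) := fun n x hn => by
    rw [← Real.rpow_natCast, Nat.cast_sub hn, Nat.cast_one]
  have e2 := e (d ^ 2) (l 1) (Nat.one_le_pow _ _ hd)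
  push_cast at e2
  unfold dirichletPDFReal jointDensity
  refine if_congr ?_ ?_ rfl
  · simp [Fin.forall_fin_two, Fin.sum_univ_two, and_assoc]
  · have h2 : (Fin.last 2) = 2 := rfl
    simp [Fin.sum_univ_three, Fin.prod_univ_three, Fin.prod_univ_two, h2, e d _ hd, e2]
    ring

theorem map_jointMeasure_eq_dirichletMeasure {d : ℕ} (hd : 1 ≤ d) :
    (jointMeasure d (d ^ 2)).map (fun x => ![x.1, x.2, 1 - x.1 - x.2]) =
      dirichletMeasure ![(d : ℝ), (d : ℝ) ^ 2, 1] := by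
  have hmp : MeasurePreserving (MeasurableEquiv.finTwoArrow : (Fin 2 → ℝ) ≃ᵐ ℝ × ℝ) :=
    volume_preserving_finTwoArrow ℝ
  have h1 : (volume.withDensity fun l : Fin 2 → ℝ =>
      ENNReal.ofReal (dirichletPDFReal ![(d : ℝ), (d : ℝ) ^ 2, 1] l)).map
        MeasurableEquiv.finTwoArrow = jointMeasure d (d ^ 2) := by
    ext S hS
    rw [Measure.map_apply hmp.measurable hS, jointMeasure, withDensity_apply _ hS,
      withDensity_apply _ (hmp.measurable hS), ← hmp.setLIntegral_comp_preimage hS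
        (measurable_ofReal_jointDensity d (d ^ 2))]
    simp_rw [dirichletPDFReal_eq_jointDensity hd]
    rfl
  have hm : Measurable fun x : ℝ × ℝ => ![x.1, x.2, 1 - x.1 - x.2] := by
    refine measurable_pi_iff.2 fun i => ?_
    fin_cases i <;> simp <;> fun_prop
  rw [← h1, Measure.map_map hm hmp.measurable, dirichletMeasure]
  congr 1
  funext l i
  fin_cases i
  · rfl
  · rfl
  · change 1 - l 0 - l 1 = 1 - ∑ i, l i
    rw [Fin.sum_univ_two]
    ring

/-! ### The joint law of Δ and Ω under Lebesgue measure -/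

section JointLaw

open scoped Pointwise

variable {d : ℕ}

/-- The tuples of affinely independent points whose circumcenter has norm at most `a` and whose
circumradius is at most `b`. -/
def boundedTuples (d : ℕ) (a b : ℝ) : Set (Fin (d + 1) → EuclideanSpace ℝ (Fin d)) :=
  independentTuples d ∩ {p | centerDist p ≤ a ∧ circumRad p ≤ b}

/-- Every point lies within a + b of the origin. -/
theorem volume_boundedTuples_lt_top (a b : ℝ) : volume (boundedTuples d a b) < ⊤ := by
  refine (measure_mono (t := Set.univ.pi fun _ => Metric.closedBall 0 (a + b)) ?_).trans_lt ?_
  · intro p hp i _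
    have h := dist_center_pointsCircumsphere hp.1 i
    have h1 := hp.2.1
    have h2 := hp.2.2
    rw [centerDist, dist_comm] at h1
    exact (dist_triangle _ _ _).trans (by linarith)
  · exact ((isCompact_univ_pi fun _ => isCompact_closedBall _ _).measure_lt_top)

theorem volume_boundedTuples_smul {s : ℝ} (hs : 0 < s) (a b : ℝ) :
    volume (boundedTuples d (s * a) (s * b)) =
      ENNReal.ofReal s ^ ((d + 1) * d) * volume (boundedTuples d a b) := by
  have hset : boundedTuples d (s * a) (s * b) = s • boundedTuples d a b := by
    ext p
    rw [Set.mem_smul_set_iff_inv_smul_mem₀ hs.ne']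
    constructor
    · rintro ⟨hp, h1, h2⟩
      obtain ⟨e1, e2⟩ := pointsCircumsphere_const_smul hp (inv_pos.2 hs)
      refine ⟨(affineIndependent_const_smul_iff (inv_ne_zero hs.ne')).2 hp, ?_, ?_⟩
      · rw [e1]; exact (inv_mul_le_iff₀ hs).2 h1
      · rw [e2]; exact (inv_mul_le_iff₀ hs).2 h2
    · rintro ⟨hp, h1, h2⟩
      have hp' := (affineIndependent_const_smul_iff (inv_ne_zero hs.ne')).1 hp
      obtain ⟨e1, e2⟩ := pointsCircumsphere_const_smul hp' (inv_pos.2 hs)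
      rw [e1] at h1
      rw [e2] at h2
      exact ⟨hp', (inv_mul_le_iff₀ hs).1 h1, (inv_mul_le_iff₀ hs).1 h2⟩
  rw [hset, Measure.addHaar_smul_of_nonneg _ hs.le, ENNReal.ofReal_pow hs.le]
  congr 2
  simp [Module.finrank_pi_fintype]

/-- The distribution of the circumcenter, for the Lebesgue measure on the tuples of affinely
independent points of circumradius at most one. -/
noncomputable def centerMeasure (d : ℕ) : Measure (EuclideanSpace ℝ (Fin d)) :=
  (volume.restrict (independentTuples d ∩ {p | circumRad p ≤ 1})).map
    fun p => (pointsCircumsphere p).center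

theorem centerMeasure_apply {s : Set (EuclideanSpace ℝ (Fin d))} (hs : MeasurableSet s) :
    centerMeasure d s = volume ((fun p => (pointsCircumsphere p).center) ⁻¹' s ∩
      (independentTuples d ∩ {p | circumRad p ≤ 1})) := by
  rw [centerMeasure, Measure.map_apply (measurable_center d) hs,
    Measure.restrict_apply (measurable_center d hs)]

theorem centerMeasure_closedBall (a : ℝ) :
    centerMeasure d (Metric.closedBall 0 a) = volume (boundedTuples d a 1) := by
  rw [centerMeasure_apply measurableSet_closedBall]
  congr 1
  ext p
  simp only [boundedTuples, centerDist, Set.mem_inter_iff, Set.mem_preimage,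
    Metric.mem_closedBall', Set.mem_ofPred_eq]
  tauto

instance : IsFiniteMeasureOnCompacts (centerMeasure d) where
  lt_top_of_isCompact K hK := by
    obtain ⟨R, hR⟩ := hK.isBounded.subset_closedBall 0
    refine (measure_mono hR).trans_lt ?_
    rw [centerMeasure_closedBall]
    exact volume_boundedTuples_lt_top R 1

instance : (centerMeasure d).IsAddLeftInvariant where
  map_add_left_eq_self t := by
    ext s hs
    have hm : Measurable (t + · : EuclideanSpace ℝ (Fin d) → _) := measurable_const_add t
    rw [Measure.map_apply hm hs, centerMeasure_apply hs, centerMeasure_apply (hm hs),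
      ← measure_preimage_add volume (fun _ => t : Fin (d + 1) → EuclideanSpace ℝ (Fin d))
        ((fun p => (pointsCircumsphere p).center) ⁻¹' s ∩
          (independentTuples d ∩ {p | circumRad p ≤ 1}))]
    congr 1
    ext p
    by_cases hp : AffineIndependent ℝ p
    · obtain ⟨e1, e2⟩ := pointsCircumsphere_const_add hp t
      simp [independentTuples, e1, e2, hp, affineIndependent_const_add_iff]
    · simp [independentTuples, hp, affineIndependent_const_add_iff]

/-- Uniqueness of Haar measure makes `centerMeasure d` a multiple of Lebesgue measure, so balls of
radius a have mass proportional to a^d. -/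
theorem volume_boundedTuples_one {a : ℝ} (ha : 0 ≤ a) :
    volume (boundedTuples d a 1) =
      ENNReal.ofReal a ^ d * volume (boundedTuples d 1 1) := by
  have h := Measure.isAddLeftInvariant_eq_smul (centerMeasure d)
    (volume : Measure (EuclideanSpace ℝ (Fin d)))
  rw [← centerMeasure_closedBall, ← centerMeasure_closedBall, h, Measure.smul_apply,
    Measure.smul_apply, Measure.addHaar_closedBall' _ _ ha, finrank_euclideanSpace_fin,
    ENNReal.ofReal_pow ha, ENNReal.smul_def, ENNReal.smul_def, smul_eq_mul, smul_eq_mul]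
  ring

theorem volume_boundedTuples (hd : 1 ≤ d) (a b : ℝ) :
    volume (boundedTuples d a b) =
      volume (boundedTuples d 1 1) * ENNReal.ofReal a ^ d * ENNReal.ofReal b ^ d ^ 2 := by
  have hd2 : d ^ 2 ≠ 0 := (pow_pos hd 2).ne'
  rcases le_or_gt b 0 with hb | hb
  · have : boundedTuples d a b = ∅ := by
      refine Set.eq_empty_of_forall_notMem fun p hp => ?_
      have := circumRad_pos hd hp.1
      have := hp.2.2
      linarith
    rw [this, ENNReal.ofReal_of_nonpos hb, zero_pow hd2]
    simp
  rcases lt_or_ge a 0 with ha | ha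
  · have : boundedTuples d a b = ∅ := by
      refine Set.eq_empty_of_forall_notMem fun p hp => ?_
      have : 0 ≤ centerDist p := dist_nonneg
      have := hp.2.1
      linarith
    rw [this, ENNReal.ofReal_of_nonpos ha.le, zero_pow (by omega)]
    simp
  -- Scaling by b reduces to radius bound 1 and center bound a / b; the exponent of b becomes d(d+1)
  -- - d = d².
  have h := volume_boundedTuples_smul (d := d) hb (a / b) 1
  rw [mul_div_cancel₀ _ hb.ne', mul_one, volume_boundedTuples_one (by positivity)] at h
  rw [h, ← ENNReal.ofReal_pow hb.le, ← ENNReal.ofReal_pow hb.le, ← ENNReal.ofReal_pow ha,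
    ← ENNReal.ofReal_pow (by positivity), ← mul_assoc, ← ENNReal.ofReal_mul (by positivity),
    mul_assoc _ _ (ENNReal.ofReal _), ← ENNReal.ofReal_mul (by positivity), mul_comm]
  congr 2
  rw [add_mul, one_mul, pow_add, div_pow, ← sq d]
  field_simp

/-- Spanning sets of finite measure among the half-lines `(-∞, r]`. -/
noncomputable def finiteSpanningSetsInIic (μ : Measure ℝ) (h : ∀ r, μ (Set.Iic r) < ⊤) :
    μ.FiniteSpanningSetsIn (Set.range Set.Iic) where
  set n := Set.Iic n
  set_mem n := ⟨n, rfl⟩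
  finite n := h n
  spanning := Set.iUnion_eq_univ_iff.2 exists_nat_ge

/-- Quadrants generate the σ-algebra, and the volume formula factors on them. -/
theorem map_centerDist_circumRad (hd : 1 ≤ d) :
    (volume.restrict (independentTuples d)).map (fun p => (centerDist p, circumRad p)) =
      volume (boundedTuples d 1 1) • (powMeasure d).prod (powMeasure (d ^ 2)) := by
  have hd2 : 1 ≤ d ^ 2 := Nat.one_le_pow _ _ hd
  have hgen : MeasurableSpace.generateFrom (Set.range (Set.Iic : ℝ → Set ℝ)) =
      Real.measurableSpace := (borel_eq_generateFrom_Iic ℝ).symm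
  rw [← Measure.prod_smul_left]
  refine (Measure.prod_eq_generateFrom hgen hgen isPiSystem_Iic isPiSystem_Iic
    (finiteSpanningSetsInIic _ fun r => ?_) (finiteSpanningSetsInIic _ fun r => ?_) ?_).symm
  · rw [Measure.smul_apply, powMeasure_Iic hd]
    exact ENNReal.mul_lt_top (volume_boundedTuples_lt_top 1 1)
      (ENNReal.pow_lt_top ENNReal.ofReal_lt_top)
  · rw [powMeasure_Iic hd2]
    exact ENNReal.pow_lt_top ENNReal.ofReal_lt_top
  · rintro _ ⟨a, rfl⟩ _ ⟨b, rfl⟩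
    have hm := (measurable_centerDist d).prodMk (measurable_circumRad d)
    have hs : MeasurableSet (Set.Iic a ×ˢ Set.Iic b : Set (ℝ × ℝ)) :=
      measurableSet_Iic.prod measurableSet_Iic
    rw [Measure.map_apply hm hs, Measure.restrict_apply (hm hs), Measure.smul_apply,
      powMeasure_Iic hd, powMeasure_Iic hd2, smul_eq_mul, ← volume_boundedTuples hd]
    congr 1
    ext p
    simp only [boundedTuples, Set.mem_inter_iff, Set.mem_preimage, Set.mem_prod, Set.mem_Iic,
      Set.mem_ofPred_eq]
    tauto

/-- Otherwise the pushforward would vanish, although the independent tuples form a nonempty open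
set. -/
theorem volume_boundedTuples_one_one_ne_zero (hd : 1 ≤ d) :
    volume (boundedTuples d 1 1) ≠ 0 := by
  intro h
  have hM := map_centerDist_circumRad hd
  have hm := (measurable_centerDist d).prodMk (measurable_circumRad d)
  rw [h, zero_smul, Measure.map_eq_zero_iff hm.aemeasurable, Measure.restrict_eq_zero] at hM
  exact (isOpen_independentTuples d).measure_ne_zero _ (independentTuples_nonempty d) hM

theorem map_restrict_circumsphereInBall (hd : 1 ≤ d) :
    ∃ K : ENNReal, K ≠ 0 ∧ K ≠ ⊤ ∧
      (volume.restrict (circumsphereInBall d)).map (fun p => (centerDist p, circumRad p)) =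
        K • jointMeasure d (d ^ 2) := by
  obtain ⟨K, hK0, hK, h⟩ := restrict_prod_powMeasure hd (Nat.one_le_pow 2 d hd)
  refine ⟨volume (boundedTuples d 1 1) * K,
    mul_ne_zero (volume_boundedTuples_one_one_ne_zero hd) hK0,
    ENNReal.mul_ne_top (volume_boundedTuples_lt_top 1 1).ne hK, ?_⟩
  have hm := (measurable_centerDist d).prodMk (measurable_circumRad d)
  have hD : MeasurableSet {x : ℝ × ℝ | x.1 + x.2 ≤ 1} :=
    measurableSet_le (measurable_fst.add measurable_snd) measurable_const
  rw [mul_smul, ← h, ← Measure.restrict_smul, ← map_centerDist_circumRad hd,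
    Measure.restrict_map hm hD, Measure.restrict_restrict (hm hD), circumsphereInBall_eq hd,
    Set.inter_comm]
  rfl

end JointLaw

/-! ### From Lebesgue measure to the conditioned uniform sample -/

/-- The event already forces the points into the closed ball, which exceeds the open ball by a null
set. -/
theorem volume_restrict_circumsphereInBall_pi_ball (d : ℕ) (hd : 1 ≤ d) :
    (volume.restrict (Set.univ.pi fun _ : Fin (d + 1) =>
      Metric.ball (0 : EuclideanSpace ℝ (Fin d)) 1)).restrict (circumsphereInBall d) =
      volume.restrict (circumsphereInBall d) := by
  rw [Measure.restrict_restrict (measurableSet_circumsphereInBall hd)]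
  refine Measure.restrict_congr_set ?_
  have h : (Set.univ.pi fun _ : Fin (d + 1) => Metric.ball (0 : EuclideanSpace ℝ (Fin d)) 1)
      =ᵐ[volume] Set.univ.pi fun _ => Metric.closedBall 0 1 := by
    refine Measure.ae_eq_set_pi fun _ _ => ?_
    refine ae_eq_of_subset_of_measure_ge Metric.ball_subset_closedBall ?_
      measurableSet_ball.nullMeasurableSet measure_closedBall_lt_top.ne
    rw [Measure.addHaar_unitClosedBall_eq_addHaar_unitBall]
  have h' := (ae_eq_refl (circumsphereInBall d)).inter h
  rwa [Set.inter_eq_left.2 circumsphereInBall_subset_closedBall] at h'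

theorem pi_cond_eq_smul_restrict {ι E : Type*} [Fintype ι] [MeasureSpace E]
    [SigmaFinite (volume : Measure E)] (s : Set E) :
    (Measure.pi fun _ : ι => (volume : Measure E)[|s]) =
      (volume s)⁻¹ ^ Fintype.card ι • volume.restrict (Set.univ.pi fun _ : ι => s) := by
  have : SigmaFinite ((volume : Measure E)[|s]) := by
    rcases eq_or_ne (volume s) 0 with h | h
    · rw [ProbabilityTheory.cond, Measure.restrict_eq_zero.2 h, smul_zero]; infer_instance
    · have : IsFiniteMeasure ((volume : Measure E)[|s]) := inferInstance
      infer_instance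
  refine Measure.pi_eq fun t _ => ?_
  rw [Measure.smul_apply, volume_pi, Measure.restrict_pi_pi, Measure.pi_pi]
  simp [ProbabilityTheory.cond, Finset.prod_mul_distrib]

theorem map_cond_circumsphereInBall {S : Type*} [MeasurableSpace S] (P : Measure S)
    [IsProbabilityMeasure P] {d : ℕ} (hd : 1 ≤ d) (A : Fin (d + 1) → S → EuclideanSpace ℝ (Fin d))
    (hA_indep : iIndepFun A P)
    (hA_unif : ∀ i, pdf.IsUniform (A i) (Metric.ball 0 1) P volume) :
    HasLaw (fun s => (centerDist fun i => A i s, circumRad fun i => A i s))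
      (jointMeasure d (d ^ 2)) P[|{s | (fun i => A i s) ∈ circumsphereInBall d}] := by
  have hv0 : volume (Metric.ball (0 : EuclideanSpace ℝ (Fin d)) 1) ≠ 0 :=
    (Metric.measure_ball_pos _ _ one_pos).ne'
  have hv : volume (Metric.ball (0 : EuclideanSpace ℝ (Fin d)) 1) ≠ ⊤ :=
    measure_ball_lt_top.ne
  have hAi : ∀ i, AEMeasurable (A i) P := fun i => (hA_unif i).aemeasurable hv0 hv
  have hA : AEMeasurable (fun s i => A i s) P := aemeasurable_pi_lambda _ hAi
  have hg : Measurable fun p : Fin (d + 1) → EuclideanSpace ℝ (Fin d) =>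
      (centerDist p, circumRad p) := (measurable_centerDist d).prodMk (measurable_circumRad d)
  have hE := measurableSet_circumsphereInBall hd
  set F := {s | (fun i => A i s) ∈ circumsphereInBall d} with hF
  obtain ⟨K, hK0, hK, hmap⟩ := map_restrict_circumsphereInBall hd
  have hlaw : P.map (fun s i => A i s) =
      (volume (Metric.ball (0 : EuclideanSpace ℝ (Fin d)) 1))⁻¹ ^ (d + 1) •
        volume.restrict (Set.univ.pi fun _ => Metric.ball 0 1) := by
    rw [hA_indep.map_fun_eq_pi_map hAi]
    have : ∀ i, P.map (A i) = volume[|Metric.ball 0 1] := hA_unif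
    simp_rw [this]
    rw [pi_cond_eq_smul_restrict, Fintype.card_fin]
  obtain ⟨κ, hκ0, hκ, h⟩ : ∃ κ : ENNReal, κ ≠ 0 ∧ κ ≠ ⊤ ∧
      (P.restrict F).map (fun s => (centerDist fun i => A i s, circumRad fun i => A i s)) =
        κ • jointMeasure d (d ^ 2) := by
    refine ⟨_, mul_ne_zero (pow_ne_zero (d + 1) (ENNReal.inv_ne_zero.2 hv)) hK0,
      ENNReal.mul_ne_top (ENNReal.pow_ne_top (ENNReal.inv_ne_top.2 hv0)) hK, ?_⟩
    rw [mul_smul, ← hmap, ← volume_restrict_circumsphereInBall_pi_ball d hd, ← Measure.map_smul,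
      ← Measure.restrict_smul, ← hlaw, Measure.restrict_map_of_aemeasurable hA hE,
      AEMeasurable.map_map_of_aemeasurable hg.aemeasurable hA.restrict]
    rfl
  have hgA : AEMeasurable (fun s => (centerDist fun i => A i s, circumRad fun i => A i s)) P :=
    hg.comp_aemeasurable hA
  have := isProbabilityMeasure_jointMeasure hd (Nat.one_le_pow 2 d hd)
  -- As `jointMeasure` has mass 1, the unknown constant is the probability of the event, which is
  -- therefore positive.
  have hPF : P F = κ := by
    have := congrArg (· Set.univ) h
    simpa [Measure.map_apply_of_aemeasurable hgA.restrict MeasurableSet.univ] using this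
  refine ⟨hgA.mono_ac cond_absolutelyContinuous, ?_⟩
  rw [ProbabilityTheory.cond, Measure.map_smul, h, hPF, smul_smul, ENNReal.inv_mul_cancel hκ0 hκ,
    one_smul]

theorem mainTheorem3 {S : Type*} [MeasurableSpace S] (P : Measure S) [IsProbabilityMeasure P]
    (d : ℕ) (hd : 1 ≤ d)
    (A : Fin (d + 1) → S → EuclideanSpace ℝ (Fin d))
    (hA_indep : iIndepFun A P)
    (hA_unif : ∀ i, pdf.IsUniform (A i) (Metric.ball 0 1) P volume)
    -- the points, as functions of the outcome; `Δ` and `Ω`; and the conditional probability given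
    -- that the circumsphere is contained in the unit ball
    (Δ Ω : S → ℝ)
    (hΔ : Δ = fun s => centerDist fun i => A i s)
    (hΩ : Ω = fun s => circumRad fun i => A i s)
    (Q : Measure S)
    (hQ : Q = P[|{s | (fun i => A i s) ∈ circumsphereInBall d}]) :
    HasLaw (fun s => ![Δ s, Ω s, 1 - Δ s - Ω s])
      (dirichletMeasure ![(d : ℝ), (d : ℝ) ^ 2, 1]) Q ∧
    HasLaw (fun s => (Δ s, Ω s))
      ((volume : Measure (ℝ × ℝ)).withDensity fun x =>
        ENNReal.ofReal (if 0 < x.1 ∧ 0 < x.2 ∧ x.1 + x.2 < 1 then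
          (d : ℝ) * (d + 1) / beta d ((d : ℝ) ^ 2) * x.1 ^ (d - 1) * x.2 ^ (d ^ 2 - 1) else 0)) Q ∧
    HasLaw Δ (betaMeasure d ((d : ℝ) ^ 2 + 1)) Q ∧
    HasLaw Ω (betaMeasure ((d : ℝ) ^ 2) (d + 1)) Q := by
  subst hΔ hΩ hQ
  have h := map_cond_circumsphereInBall P hd A hA_indep hA_unif
  have hd2 : 1 ≤ d ^ 2 := Nat.one_le_pow 2 d hd
  refine ⟨?_, ?_, ?_, ?_⟩
  · have hm : Measurable fun x : ℝ × ℝ => ![x.1, x.2, 1 - x.1 - x.2] := by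
      refine measurable_pi_iff.2 fun i => ?_
      fin_cases i <;> simp <;> fun_prop
    exact HasLaw.comp ⟨hm.aemeasurable, map_jointMeasure_eq_dirichletMeasure hd⟩ h
  · simp_rw [jointDensity_eq hd]
    exact h
  · have h1 : HasLaw Prod.fst (betaMeasure d ((d : ℝ) ^ 2 + 1)) (jointMeasure d (d ^ 2)) :=
      ⟨measurable_fst.aemeasurable, by simpa using map_fst_jointMeasure hd hd2⟩
    exact h1.comp h
  · have h2 : HasLaw Prod.snd (betaMeasure ((d : ℝ) ^ 2) (d + 1)) (jointMeasure d (d ^ 2)) :=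
      ⟨measurable_snd.aemeasurable, by simpa using map_snd_jointMeasure hd hd2⟩
    exact h2.comp h
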